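/- For integers $p,n,k\ge 1$ let $A(p,n,k)$ be the number of ordered $p$-tuples $(\sigma_1,\ldots,\sigma_p)$ of pairwise commuting permutations of $\{1,\ldots,n\}$ such that the subgroup $\langle\sigma_1,\ldots,\sigma_p\rangle$ of the symmetric group has exactly $k$ orbits on $\{1,\ldots,n\}$. For $1\le k\le n$ let $$E(n,k)=\max\{a_1\cdots a_k : a_1,\ldots,a_k\ge 1 \text{ integers},\ a_1+\cdots+a_k=n\}.$$ Let $H$ be the multiplicative arithmetic function given, for an integer $N\ge 1$ with prime factorization $N=q_1^{m_1}\cdots q_\ell^{m_\ell}$, by $$H(N)=\prod_{i=1}^{\ell}\frac{q_i^{\binom{m_i}{2}-m_i}}{(q_i-1)(q_i^2-1)\cdots(q_i^{m_i}-1)}$$ (so $H(1)=1$), and for $1\le k\le n$ let $$F(n,k)=\frac{n!}{r!\,(k-r)!}\,H(b)^{k-r}\,H(b+1)^{r},$$ where $n=bk+r$ with $0\le r<k$ is the Euclidean division of $n$ by $k$. Theorem. For all integers $n,k$ with $1\le k\le n$, one has $A(p,n,k)\sim F(n,k)\,E(n,k)^p$ as $p\to\infty$, that is, $$\lim_{p\to\infty}\frac{A(p,n,k)}{F(n,k)\,E(n,k)^p}=1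 .$$ -/

import Mathlib

namespace CommutingPerms

/-- The number of orbits on `{1, …, n}` (modelled by `Fin n`) of the subgroup of the symmetric
group generated by the permutations `σ 0, …, σ (p - 1)`. -/
noncomputable def orbitCount {p n : ℕ} (σ : Fin p → Equiv.Perm (Fin n)) : ℕ :=
  Nat.card (MulAction.orbitRel.Quotient (Subgroup.closure (Set.range σ)) (Fin n))

/-- `A p n k`: the number of ordered `p`-tuples of pairwise commuting permutations of `n` elements
that generate a subgroup with exactly `k` orbits. -/
noncomputable def A (p n k : ℕ) : ℕ :=
  Nat.card {σ : Fin p → Equiv.Perm (Fin n) //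
    (∀ i j, σ i * σ j = σ j * σ i) ∧ orbitCount σ = k}

/-- The finite set of all `k`-tuples of integers `≥ 1` with sum `n`. -/
def compositions (n k : ℕ) : Finset (Fin k → ℕ) :=
  (Finset.Nat.antidiagonalTuple k n).filter fun a => ∀ i, 1 ≤ a i

/-- `E n k`: the maximum of `a₁ ⋯ a_k` over all `k`-tuples of integers `≥ 1` with sum `n`
(used only for `1 ≤ k ≤ n`, where such tuples exist). -/
def E (n k : ℕ) : ℕ :=
  (compositions n k).sup fun a => ∏ i, a i

/-- For `1 ≤ k ≤ n`, the number `E n k` really is a maximum. -/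
theorem isGreatest_E {n k : ℕ} (hk : 1 ≤ k) (hkn : k ≤ n) :
    IsGreatest {m : ℕ | ∃ a : Fin k → ℕ, (∀ i, 1 ≤ a i) ∧ ∑ i, a i = n ∧ ∏ i, a i = m}
      (E n k) := by
  have hmem : ∀ a : Fin k → ℕ, a ∈ compositions n k ↔ (∀ i, 1 ≤ a i) ∧ ∑ i, a i = n := by
    intro a
    simp [compositions, Finset.Nat.mem_antidiagonalTuple, and_comm]
  have hne : (compositions n k).Nonempty := by
    refine ⟨fun i => 1 + if i = (⟨0, hk⟩ : Fin k) then n - k else 0, ?_⟩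
    rw [hmem]
    refine ⟨fun i => by omega, ?_⟩
    simp [Finset.sum_add_distrib]
    omega
  constructor
  · obtain ⟨a, ha, h⟩ := Finset.exists_mem_eq_sup _ hne fun a : Fin k → ℕ => ∏ i, a i
    obtain ⟨h1, h2⟩ := (hmem a).1 ha
    exact ⟨a, h1, h2, h.symm⟩
  · rintro m ⟨a, h1, h2, rfl⟩
    exact Finset.le_sup (f := fun a : Fin k → ℕ => ∏ i, a i) ((hmem a).2 ⟨h1, h2⟩)

/-- The arithmetic function `H`: for `n ≥ 1` the product, over the prime powers `q ^ m` exactly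
dividing `n`, of `q ^ (binom(m, 2) - m) / ((q - 1) (q ^ 2 - 1) ⋯ (q ^ m - 1))`.
The exponent `binom(m, 2) - m` is an integer, possibly negative. -/
noncomputable def H (n : ℕ) : ℝ :=
  n.factorization.prod fun q m =>
    (q : ℝ) ^ ((m.choose 2 : ℤ) - (m : ℤ)) / ∏ j ∈ Finset.Icc 1 m, ((q : ℝ) ^ j - 1)

/-- `H` is multiplicative. -/
theorem H_mul {m n : ℕ} (h : m.Coprime n) : H (m * n) = H m * H n := by
  unfold H
  rw [Nat.factorization_mul_of_coprime h]
  exact Finsupp.prod_add_index_of_disjoint h.disjoint_primeFactors _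

/-- `F n k = n! / (r! (k - r)!) * H(b) ^ (k - r) * H(b + 1) ^ r`, where `b = n / k` and `r = n % k`
are the quotient and the remainder of the division of `n` by `k` (so that `r < k` when `1 ≤ k`). -/
noncomputable def F (n k : ℕ) : ℝ :=
  (n.factorial : ℝ) / ((n % k).factorial * (k - n % k).factorial) *
    H (n / k) ^ (k - n % k) * H (n / k + 1) ^ (n % k)

end CommutingPerms

/-! Labelling the orbits turns `k! * A p n k` into a sum, over surjections `f` onto `Fin k`, of
products over the fibres of `f` of numbers of commuting transitive `p`-tuples (`A_mul_factorial`).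
Such tuples on `n` points are transitive actions of `ℤ^p`; together with a base point they are coset
spaces, so `transCount p n = (n - 1)! * s_p(n)`, where `s_p(n)` is the number of subgroups of index
`n` in `ℤ^p` (`transCount_mul`).

Splitting off one coordinate gives `s_{p+1}(n) = ∑_{d ∣ n} d s_p(d)`; as Dirichlet convolutions this
can be rewritten `s_{p+1}(n) = ∑_{d ∣ n} (n/d)^p s_p(d)` (`subgroupCount_succ'`). Hence `u_p(n) =
s_p(n) / n^p` satisfies `u_{p+1}(n) = n⁻¹ ∑_{d ∣ n} u_p(d)`. For `n > 1` this is a contraction in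
`u_p(n)`, driven by proper divisors, so `u_p(n)` converges to the solution of `n L(n) = ∑_{d ∣ n}
L(d)`, `L(1) = 1`, which is `L(n) = n H(n)` (`sum_divisors_mulH`).

A surjection with fibre sizes `a_j` therefore contributes about a constant times `(∏ a_j)^p`. Only
the maximisers of `∏ a_j` survive division by `E n k ^ p`; they are the vectors with all entries `b`
or `b + 1` (`prod_eq_E_iff_balanced`), and counting the corresponding maps gives `F n k`
(`sum_balanced_eq`). -/

namespace CommutingPerms
-- Decomposition into orbits
open Equiv

/-- `x` and `y` lie in the same orbit of the group generated by the `σ i`. -/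
def SameOrbit {p : ℕ} {X : Type*} (σ : Fin p → Perm X) (x y : X) : Prop :=
  ∃ g ∈ Subgroup.closure (Set.range σ), g x = y

/-- The `p`-tuples of commuting permutations of `X` generating a transitive group. -/
def TransTuple (p : ℕ) (X : Type*) : Type _ :=
  {σ : Fin p → Perm X // (∀ i j, σ i * σ j = σ j * σ i) ∧ ∀ x y, SameOrbit σ x y}

/-- The number of `p`-tuples of commuting permutations of `Fin n` generating a transitive group. -/
noncomputable def transCount (p n : ℕ) : ℕ := Nat.card (TransTuple p (Fin n))

instance {p : ℕ} {X : Type*} [Finite X] : Finite (TransTuple p X) := by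
  unfold TransTuple; infer_instance

section fibers
variable {X ι : Type*} (f : X → ι)

/-- The permutation of `X` glued from permutations of the fibres of `f`. -/
def glueFibers : (∀ j, Perm {x // f x = j}) →* Perm X where
  toFun g := Equiv.ofFiberEquiv (f := f) (g := f) g
  map_one' := by ext x; simp [Equiv.ofFiberEquiv]
  map_mul' g h := by
    ext x
    have h1 : f (h (f x) ⟨x, rfl⟩) = f x := (h (f x) ⟨x, rfl⟩).2
    have key : ∀ (j : ι) (y : {x // f x = j}),
        ((g (f y) ⟨y, rfl⟩ : {x // f x = f y}) : X) = (g j y : X) := by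
      rintro _ ⟨y, rfl⟩; rfl
    have := key _ (h (f x) ⟨x, rfl⟩)
    exact this.symm

theorem glueFibers_apply (g : ∀ j, Perm {x // f x = j}) (j : ι) (x : {x // f x = j}) :
    glueFibers f g x = (g j x : X) := by
  obtain ⟨x, rfl⟩ := x; rfl

theorem map_glueFibers (g : ∀ j, Perm {x // f x = j}) (x : X) : f (glueFibers f g x) = f x :=
  Equiv.ofFiberEquiv_map _ _

theorem glueFibers_injective : Function.Injective (glueFibers f) := by
  intro g h hgh
  funext j
  ext x
  rw [← glueFibers_apply, ← glueFibers_apply, hgh]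

theorem exists_glueFibers_eq (s : Perm X) (hs : ∀ x, f (s x) = f x) :
    ∃ g, glueFibers f g = s := by
  refine ⟨fun j => s.subtypePerm (fun x => by rw [hs]), ?_⟩
  ext x
  exact glueFibers_apply f _ (f x) ⟨x, rfl⟩

variable {p : ℕ} (τ : Fin p → ∀ j, Perm {x // f x = j})

theorem sameOrbit_glueFibers {x y : X} :
    SameOrbit (fun i => glueFibers f (τ i)) x y ↔
      ∃ g ∈ Subgroup.closure (Set.range τ), glueFibers f g x = y := by
  have : Subgroup.closure (Set.range fun i => glueFibers f (τ i)) =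
      (Subgroup.closure (Set.range τ)).map (glueFibers f) := by
    rw [MonoidHom.map_closure, ← Set.range_comp]; rfl
  simp [SameOrbit, this]

theorem sameOrbit_fiber {j : ι} {x y : {x // f x = j}} :
    SameOrbit (fun i => τ i j) x y ↔ ∃ g ∈ Subgroup.closure (Set.range τ), g j x = y := by
  have : Subgroup.closure (Set.range fun i => τ i j) =
      (Subgroup.closure (Set.range τ)).map (Pi.evalMonoidHom _ j) := by
    rw [MonoidHom.map_closure, ← Set.range_comp]; rfl
  simp [SameOrbit, this]

/-- The generated group is the image of one subgroup of the product of the symmetric groups of the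
fibres, and an element of it acts on fibre `j` through its `j`-th component. Transitivity on each
fibre thus suffices, although the components are not independent. -/
theorem glueFibers_sameOrbit_iff :
    (∀ x y, f x = f y ↔ SameOrbit (fun i => glueFibers f (τ i)) x y) ↔
      ∀ j x y, SameOrbit (fun i => τ i j) x y := by
  constructor
  · intro h j x y
    obtain ⟨g, hg, hxy⟩ := (sameOrbit_glueFibers f τ).1 ((h x y).1 (x.2.trans y.2.symm))
    refine (sameOrbit_fiber f τ).2 ⟨g, hg, ?_⟩
    rw [glueFibers_apply] at hxy
    exact Subtype.ext hxy
  · intro h x y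
    rw [sameOrbit_glueFibers]
    constructor
    · intro hxy
      obtain ⟨g, hg, hgx⟩ := (sameOrbit_fiber f τ).1 (h (f y) ⟨x, hxy⟩ ⟨y, rfl⟩)
      exact ⟨g, hg, by rw [glueFibers_apply f g (f y) ⟨x, hxy⟩, hgx]⟩
    · rintro ⟨g, -, rfl⟩
      exact (map_glueFibers f g x).symm

/-- Commuting tuples whose orbits are the fibres of `f` are families of commuting transitive
tuples on the fibres. -/
theorem card_tuples_of_orbits (p : ℕ) [Finite X] [Fintype ι] :
    Nat.card {σ : Fin p → Perm X // (∀ i j, σ i * σ j = σ j * σ i) ∧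
      ∀ x y, f x = f y ↔ SameOrbit σ x y} =
      ∏ j, Nat.card (TransTuple p {x // f x = j}) := by
  rw [← Nat.card_pi]
  symm
  refine Nat.card_congr (Equiv.ofBijective
    (fun t => ⟨fun i => glueFibers f fun j => (t j).1 i, ?_, ?_⟩) ⟨?_, ?_⟩)
  · intro i j
    rw [← map_mul, ← map_mul]
    congr 1
    funext l
    exact (t l).2.1 i j
  · exact (glueFibers_sameOrbit_iff f fun i j => (t j).1 i).2 fun j => (t j).2.2
  · intro t u htu
    funext j
    refine Subtype.ext (funext fun i => ?_)
    exact congrFun (glueFibers_injective f (congrFun (Subtype.ext_iff.1 htu) i)) j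
  · rintro ⟨σ, hc, ho⟩
    have hf : ∀ i x, f (σ i x) = f x := fun i x =>
      ((ho x (σ i x)).2 ⟨σ i, Subgroup.subset_closure ⟨i, rfl⟩, rfl⟩).symm
    choose τ hτ using fun i => exists_glueFibers_eq f (σ i) (hf i)
    have hσ : σ = fun i => glueFibers f (τ i) := (funext hτ).symm
    subst hσ
    refine ⟨fun j => ⟨fun i => τ i j, fun a b => ?_, ?_⟩, rfl⟩
    · have := hc a b
      rw [← map_mul, ← map_mul] at this
      exact congrFun (glueFibers_injective f this) j
    · exact (glueFibers_sameOrbit_iff f τ).1 ho j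

end fibers

theorem sameOrbit_conj {p : ℕ} {X Y : Type*} (e : X ≃ Y) (σ : Fin p → Perm X) (x y : X)
    (h : SameOrbit σ x y) : SameOrbit (fun i => e.permCongrHom (σ i)) (e x) (e y) := by
  obtain ⟨g, hg, rfl⟩ := h
  refine ⟨e.permCongrHom g, ?_, by simp [Equiv.permCongrHom, Equiv.permCongr_apply]⟩
  have := Subgroup.mem_map_of_mem (e.permCongrHom : Perm X →* Perm Y) hg
  rw [MonoidHom.map_closure, ← Set.range_comp] at this
  exact this

/-- Transport of commuting transitive tuples along a bijection. -/
def TransTuple.map {p : ℕ} {X Y : Type*} (e : X ≃ Y) (t : TransTuple p X) : TransTuple p Y :=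
  ⟨fun i => e.permCongrHom (t.1 i), fun i j => by rw [← map_mul, t.2.1, map_mul], fun x y => by
    simpa using sameOrbit_conj e t.1 _ _ (t.2.2 (e.symm x) (e.symm y))⟩

theorem card_transTuple (p : ℕ) (X : Type*) [Finite X] :
    Nat.card (TransTuple p X) = transCount p (Nat.card X) := by
  have e := Finite.equivFin X
  refine Nat.card_congr ⟨TransTuple.map e, TransTuple.map e.symm, fun t => ?_, fun t => ?_⟩
  · refine Subtype.ext (funext fun i => ?_)
    ext x; simp [TransTuple.map, Equiv.permCongrHom, Equiv.permCongr_apply]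
  · refine Subtype.ext (funext fun i => ?_)
    ext x; simp [TransTuple.map, Equiv.permCongrHom, Equiv.permCongr_apply]

-- A labelling is a bijection from the quotient to `Fin k`. Finiteness is demanded because
-- `Nat.card` of an infinite quotient is `0`, which would wrongly match `k = 0`.
open Classical in
theorem card_labelings {X : Type*} (r : Setoid X) (k : ℕ) :
    Nat.card {f : X → Fin k // f.Surjective ∧ ∀ x y, f x = f y ↔ r x y} =
      if Nat.card (Quotient r) = k ∧ Finite (Quotient r) then k.factorial else 0 := by
  have h : Nat.card {f : X → Fin k // f.Surjective ∧ ∀ x y, f x = f y ↔ r x y} =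
      Nat.card (Quotient r ≃ Fin k) := by
    symm
    refine Nat.card_congr (Equiv.ofBijective (fun e => ⟨fun x => e ⟦x⟧, ?_, ?_⟩) ⟨?_, ?_⟩)
    · exact e.surjective.comp Quotient.mk_surjective
    · intro x y
      rw [e.apply_eq_iff_eq, Quotient.eq]
    · intro e e' h
      ext q
      induction q using Quotient.ind with
      | _ x => exact congrArg Fin.val (congrFun (Subtype.ext_iff.1 h) x)
    · rintro ⟨f, hf, hr⟩
      refine ⟨Equiv.ofBijective (Quotient.lift f fun x y h => (hr x y).2 h) ⟨?_, ?_⟩, ?_⟩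
      · intro a b
        induction a using Quotient.ind
        induction b using Quotient.ind
        intro h
        exact Quotient.sound ((hr _ _).1 h)
      · intro j
        obtain ⟨x, rfl⟩ := hf j
        exact ⟨⟦x⟧, rfl⟩
      · rfl
  rw [h]
  split_ifs with hk
  · obtain ⟨rfl, hfin⟩ := hk
    have e := Finite.equivFin (Quotient r)
    rw [Nat.card_congr (Equiv.equivCongr e (Equiv.refl _)), Nat.card_eq_fintype_card,
      Fintype.card_perm, Fintype.card_fin]
  · rw [Nat.card_eq_zero]
    left
    refine ⟨fun e => hk ⟨?_, Finite.of_equiv _ e.symm⟩⟩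
    rw [Nat.card_congr e, Nat.card_fin]

open Classical in
/-- Labelling the orbits: `k! * A p n k` counts pairs of a map onto `Fin k` and a commuting tuple
whose orbits are the fibres of the map. -/
theorem A_mul_factorial (p n k : ℕ) :
    A p n k * k.factorial = ∑ f : Fin n → Fin k with f.Surjective,
      ∏ j, transCount p (Nat.card {x // f x = j}) := by
  let S := {σ : Fin p → Perm (Fin n) // ∀ i j, σ i * σ j = σ j * σ i}
  let P : S → (Fin n → Fin k) → Prop := fun σ f =>
    f.Surjective ∧ ∀ x y, f x = f y ↔ SameOrbit σ.1 x y
  have : Fintype S := Fintype.ofFinite _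
  have h1 : Nat.card (Σ σ : S, {f // P σ f}) = A p n k * k.factorial := by
    rw [Nat.card_sigma]
    have : ∀ σ : S, Nat.card {f // P σ f} =
        if orbitCount σ.1 = k then k.factorial else 0 := by
      intro σ
      have hr : ∀ x y, SameOrbit σ.1 x y ↔
          (MulAction.orbitRel (Subgroup.closure (Set.range σ.1)) (Fin n)) x y := by
        intro x y
        rw [← Setoid.comm', MulAction.orbitRel_apply]
        constructor
        · rintro ⟨g, hg, h⟩
          exact ⟨⟨g, hg⟩, h⟩
        · rintro ⟨⟨g, hg⟩, h⟩
          exact ⟨g, hg, h⟩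
      simp only [P, hr]
      rw [card_labelings]
      have : Finite (Quotient (MulAction.orbitRel (Subgroup.closure (Set.range σ.1)) (Fin n))) :=
        inferInstance
      simp only [this, and_true]
      rfl
    simp only [this]
    rw [Finset.sum_ite, Finset.sum_const_zero, add_zero, Finset.sum_const, smul_eq_mul]
    congr 1
    rw [A, ← Fintype.card_subtype, ← Nat.card_eq_fintype_card]
    exact Nat.card_congr (Equiv.subtypeSubtypeEquivSubtypeInter
      (fun σ : Fin p → Perm (Fin n) => ∀ i j, σ i * σ j = σ j * σ i)
      (fun σ => orbitCount σ = k))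
  have h2 : Nat.card (Σ f : Fin n → Fin k, {σ : S // P σ f}) =
      ∑ f : Fin n → Fin k with f.Surjective,
      ∏ j, transCount p (Nat.card {x // f x = j}) := by
    rw [Nat.card_sigma, Finset.sum_filter]
    refine Finset.sum_congr rfl fun f _ => ?_
    split_ifs with hf
    · simp only [← card_transTuple]
      rw [← card_tuples_of_orbits]
      refine Nat.card_congr (Equiv.trans ?_ (Equiv.subtypeSubtypeEquivSubtypeInter
        (fun σ : Fin p → Perm (Fin n) => ∀ i j, σ i * σ j = σ j * σ i)
        (fun σ => ∀ x y, f x = f y ↔ SameOrbit σ x y)))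
      exact Equiv.subtypeEquivRight fun σ => by simp [P, hf]
    · simp [P, hf]
  rw [← h1, ← h2]
  refine Nat.card_congr ?_
  exact (Equiv.subtypeProdEquivSigmaSubtype P).symm.trans
    (((Equiv.prodComm _ _).subtypeEquiv fun _ => Iff.rfl).trans
      (Equiv.subtypeProdEquivSigmaSubtype fun f σ => P σ f))

end CommutingPerms

/-! ### Transitive actions and subgroups of finite index -/

namespace CommutingPerms
open Equiv

section actions
variable {G X : Type*} [Group G]

/-- The transitive actions of `G` on `X`. -/
def TransHom (G X : Type*) [Group G] : Type _ :=
  {φ : G →* Perm X // ∀ x y, ∃ g, φ g x = y}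

/-- The action of `G` on `X` transported from a coset space `G ⧸ K`. -/
noncomputable def cosetHom {K : Subgroup G} (e : X ≃ G ⧸ K) : G →* Perm X :=
  (e.symm.permCongrHom : Perm (G ⧸ K) →* Perm X).comp (MulAction.toPermHom G (G ⧸ K))

theorem cosetHom_apply {K : Subgroup G} (e : X ≃ G ⧸ K) (g : G) (x : X) :
    cosetHom e g x = e.symm (g • e x) := rfl

theorem cosetHom_transitive {K : Subgroup G} (e : X ≃ G ⧸ K) (x y : X) :
    ∃ g, cosetHom e g x = y := by
  obtain ⟨g, hg⟩ := MulAction.exists_smul_eq G (e x) (e y)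
  exact ⟨g, by rw [cosetHom_apply, hg, e.symm_apply_apply]⟩

theorem cosetHom_basepoint {K : Subgroup G} (e : X ≃ G ⧸ K) (g : G) :
    cosetHom e g (e.symm (1 : G)) = e.symm (g : G ⧸ K) := by
  rw [cosetHom_apply, e.apply_symm_apply, MulAction.Quotient.smul_coe, smul_eq_mul, mul_one]

/-- Transitive actions with a base point are coset spaces. -/
theorem card_transHom_mul (n : ℕ) [Finite X] (hX : Nat.card X = n) :
    Nat.card (Σ K : {K : Subgroup G // K.index = n}, (X ≃ G ⧸ K.1)) =
      Nat.card (TransHom G X) * n := by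
  conv_rhs => rw [← hX]
  rw [← Nat.card_prod]
  refine Nat.card_congr (Equiv.ofBijective
    (fun q => (⟨cosetHom q.2, cosetHom_transitive q.2⟩, q.2.symm (1 : G))) ⟨?_, ?_⟩)
  · rintro ⟨⟨K, hK⟩, e⟩ ⟨⟨L, hL⟩, e'⟩ h
    have h1 : cosetHom e = cosetHom e' := Subtype.ext_iff.1 (Prod.ext_iff.1 h).1
    have h2 : e.symm (1 : G) = e'.symm (1 : G) := (Prod.ext_iff.1 h).2
    have h3 : ∀ g : G, e.symm (g : G ⧸ K) = e'.symm (g : G ⧸ L) := fun g => by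
      rw [← cosetHom_basepoint e g, h1, h2, cosetHom_basepoint]
    -- The subgroup is recovered from the action as the stabilizer of the base point.
    have hKL : K = L := by
      ext g
      have a : g ∈ K ↔ e.symm (g : G ⧸ K) = e.symm (1 : G) := by
        rw [e.symm.apply_eq_iff_eq, eq_comm, QuotientGroup.eq]; simp
      have b : g ∈ L ↔ e'.symm (g : G ⧸ L) = e'.symm (1 : G) := by
        rw [e'.symm.apply_eq_iff_eq, eq_comm, QuotientGroup.eq]; simp
      rw [a, b, h3, h3]
    subst hKL
    have : e = e' := by
      refine Equiv.symm_bijective.injective ?_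
      ext q
      induction q using QuotientGroup.induction_on with
      | _ g => exact h3 g
    rw [this]
  · rintro ⟨⟨φ, hφ⟩, x⟩
    -- Orbit-stabilizer: the orbit map of `x` identifies `G ⧸ K` with `X`.
    let K : Subgroup G := (MulAction.stabilizer (Perm X) x).comap φ
    have hK : ∀ g, g ∈ K ↔ φ g x = x := fun g => Iff.rfl
    let q : G ⧸ K → X := Quotient.lift (fun g => φ g x) fun a b hab => by
      have := (hK _).1 (QuotientGroup.leftRel_apply.1 hab)
      rw [map_mul, map_inv, Perm.mul_apply, Perm.inv_eq_iff_eq] at this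
      exact this.symm
    have hq : ∀ g : G, q (g : G ⧸ K) = φ g x := fun g => rfl
    have hqb : q.Bijective := by
      constructor
      · intro a b hab
        induction a using QuotientGroup.induction_on
        induction b using QuotientGroup.induction_on
        rw [hq, hq] at hab
        rw [QuotientGroup.eq, hK, map_mul, map_inv, Perm.mul_apply, Perm.inv_eq_iff_eq, hab]
      · intro y
        obtain ⟨g, hg⟩ := hφ x y
        exact ⟨g, hg⟩
    let e := (Equiv.ofBijective q hqb).symm
    refine ⟨⟨⟨K, ?_⟩, e⟩, ?_⟩
    · rw [Subgroup.index, ← Nat.card_congr e, hX]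
    · have hes : ∀ g : G, e.symm (g : G ⧸ K) = φ g x := hq
      refine Prod.ext (Subtype.ext ?_) ?_
      · ext g y
        obtain ⟨a, rfl⟩ := hφ x y
        change cosetHom e g (φ a x) = _
        rw [cosetHom_apply, ← hes, e.apply_symm_apply, MulAction.Quotient.smul_coe, hes,
          smul_eq_mul, map_mul, Perm.mul_apply, hes]
      · change e.symm ((1 : G) : G ⧸ K) = x
        rw [hes, map_one, Perm.one_apply]

theorem card_equiv_of_card_eq {Y : Type*} {n : ℕ} [Finite X] (hX : Nat.card X = n)
    (hY : Nat.card Y = n) (hn : n ≠ 0) : Nat.card (X ≃ Y) = n.factorial := by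
  have : Finite Y := Nat.finite_of_card_ne_zero (hY ▸ hn)
  have e := Finite.equivFinOfCardEq hX
  have e' := Finite.equivFinOfCardEq hY
  rw [Nat.card_congr (Equiv.equivCongr e e'), Nat.card_eq_fintype_card,
      Fintype.card_perm, Fintype.card_fin]

/-- Every such subgroup carries a bijection from `X` to its coset space, so these subgroups are the
image of a set of pairs whose `Nat.card` is nonzero once a transitive action exists; without one
there are no such subgroups. -/
theorem finite_subgroup_of_index [Finite (TransHom G X)] {n : ℕ} [Finite X]
    (hX : Nat.card X = n) (hn : n ≠ 0) : Finite {K : Subgroup G // K.index = n} := by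
  have hne : ∀ K : {K : Subgroup G // K.index = n}, Nonempty (X ≃ G ⧸ K.1) := fun K => by
    by_contra h
    rw [not_nonempty_iff] at h
    have := card_equiv_of_card_eq hX K.2 hn
    rw [Nat.card_of_isEmpty] at this
    exact n.factorial_ne_zero this.symm
  have : Nonempty X := by
    by_contra h
    rw [not_nonempty_iff] at h
    exact hn (by rw [← hX, Nat.card_of_isEmpty])
  by_cases h0 : Nonempty (TransHom G X)
  · have : Finite (Σ K : {K : Subgroup G // K.index = n}, (X ≃ G ⧸ K.1)) := by
      refine Nat.finite_of_card_ne_zero ?_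
      rw [card_transHom_mul n hX]
      exact mul_ne_zero Nat.card_pos.ne' hn
    exact Finite.of_surjective (Sigma.fst (β := fun K : {K : Subgroup G // K.index = n} =>
      (X ≃ G ⧸ K.1))) fun K => ⟨⟨K, (hne K).some⟩, rfl⟩
  · have : IsEmpty {K : Subgroup G // K.index = n} :=
      ⟨fun K => h0 (Nonempty.intro (Subtype.mk (cosetHom (hne K).some) (cosetHom_transitive _)))⟩
    infer_instance

theorem card_transHom_mul_eq [Finite (TransHom G X)] {n : ℕ} [Finite X]
    (hX : Nat.card X = n) (hn : n ≠ 0) :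
    Nat.card (TransHom G X) * n = n.factorial * Nat.card {K : Subgroup G // K.index = n} := by
  have := finite_subgroup_of_index (G := G) hX hn
  have := Fintype.ofFinite {K : Subgroup G // K.index = n}
  have hf : ∀ K : {K : Subgroup G // K.index = n}, Finite (X ≃ G ⧸ K.1) := fun K =>
    Nat.finite_of_card_ne_zero (by
      rw [card_equiv_of_card_eq hX K.2 hn]; exact n.factorial_ne_zero)
  rw [← card_transHom_mul n hX, Nat.card_sigma]
  simp only [fun K : {K : Subgroup G // K.index = n} => card_equiv_of_card_eq hX K.2 hn]
  rw [Finset.sum_const, smul_eq_mul, Finset.card_univ, Nat.card_eq_fintype_card, mul_comm]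

end actions

/-- The free abelian group of rank `p`, written multiplicatively. -/
abbrev FreeAb (p : ℕ) : Type := Fin p → Multiplicative ℤ

/-- The standard basis of `FreeAb p`. -/
def FreeAb.basis (p : ℕ) (i : Fin p) : FreeAb p := Pi.mulSingle i (Multiplicative.ofAdd 1)

theorem FreeAb.closure_basis (p : ℕ) : Subgroup.closure (Set.range (FreeAb.basis p)) = ⊤ := by
  refine top_unique fun g _ => ?_
  rw [← Finset.univ_prod_mulSingle g]
  refine Subgroup.prod_mem _ fun i _ => ?_
  have : Pi.mulSingle i (g i) = FreeAb.basis p i ^ (g i).toAdd := by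
    rw [FreeAb.basis, ← Pi.mulSingle_zpow, ← ofAdd_zsmul]
    simp
  rw [this]
  exact Subgroup.zpow_mem _ (Subgroup.subset_closure (Set.mem_range_self i)) _

theorem exists_hom_freeAb {M : Type*} [Group M] {p : ℕ} (σ : Fin p → M)
    (h : ∀ i j, σ i * σ j = σ j * σ i) : ∃ φ : FreeAb p →* M, ∀ i, φ (FreeAb.basis p i) = σ i := by
  refine ⟨MonoidHom.noncommPiCoprod (fun i => zpowersHom M (σ i)) ?_, fun i => ?_⟩
  · intro i j _ x y
    exact Commute.zpow_zpow (h i j) _ _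
  · exact (MonoidHom.noncommPiCoprod_mulSingle ..).trans (by simp)

/-- Commuting transitive tuples are transitive actions of the free abelian group. -/
noncomputable def transHomEquiv (p : ℕ) (X : Type*) : TransHom (FreeAb p) X ≃ TransTuple p X := by
  have key : ∀ (φ : FreeAb p →* Perm X) (x y : X),
      SameOrbit (fun i => φ (FreeAb.basis p i)) x y ↔ ∃ g, φ g x = y := fun φ x y => by
    have : Subgroup.closure (Set.range fun i => φ (FreeAb.basis p i)) =
        (⊤ : Subgroup (FreeAb p)).map φ := by
      rw [← FreeAb.closure_basis, MonoidHom.map_closure, ← Set.range_comp]; rfl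
    simp [SameOrbit, this]
  refine Equiv.ofBijective (fun φ => ⟨fun i => φ.1 (FreeAb.basis p i), fun i j => by
    rw [← map_mul, mul_comm, map_mul], fun x y => (key φ.1 x y).2 (φ.2 x y)⟩) ⟨?_, ?_⟩
  · intro φ ψ h
    refine Subtype.ext (MonoidHom.eq_of_eqOn_dense (FreeAb.closure_basis p) ?_)
    rintro _ ⟨i, rfl⟩
    exact congrFun (Subtype.ext_iff.1 h) i
  · rintro ⟨σ, hc, ho⟩
    obtain ⟨φ, hφ⟩ := exists_hom_freeAb σ hc
    obtain rfl : (fun i => φ (FreeAb.basis p i)) = σ := funext hφ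
    exact ⟨⟨φ, fun x y => (key φ x y).1 (ho x y)⟩, rfl⟩

/-- The number of subgroups of index `n` in the free abelian group of rank `p`. -/
noncomputable def subgroupCount (p n : ℕ) : ℕ := Nat.card {K : Subgroup (FreeAb p) // K.index = n}

theorem finite_subgroups (p : ℕ) {n : ℕ} (hn : n ≠ 0) :
    Finite {K : Subgroup (FreeAb p) // K.index = n} := by
  have : Finite (TransHom (FreeAb p) (Fin n)) := Finite.of_equiv _ (transHomEquiv p (Fin n)).symm
  exact finite_subgroup_of_index (Nat.card_fin n) hn

theorem transCount_mul (p : ℕ) {n : ℕ} (hn : n ≠ 0) :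
    transCount p n * n = n.factorial * subgroupCount p n := by
  have : Finite (TransHom (FreeAb p) (Fin n)) := Finite.of_equiv _ (transHomEquiv p (Fin n)).symm
  rw [transCount, ← Nat.card_congr (transHomEquiv p (Fin n))]
  exact card_transHom_mul_eq (Nat.card_fin n) hn

end CommutingPerms

/-! ### Counting subgroups of `ℤ^p` -/

namespace CommutingPerms

/-- The trivial subgroup is included: its index is `0`, and `0` divides only `0`. -/
theorem mem_iff_index_dvd (Q : Subgroup (Multiplicative ℤ)) (x : Multiplicative ℤ) :
    x ∈ Q ↔ (Q.index : ℤ) ∣ x.toAdd := by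
  obtain ⟨R, rfl⟩ := AddSubgroup.toSubgroup.surjective Q
  obtain ⟨a, ha⟩ := Int.subgroup_cyclic R
  rw [← AddSubgroup.zmultiples_eq_closure] at ha
  rw [AddSubgroup.index_toSubgroup, ha, Int.index_zmultiples, Int.natCast_natAbs, abs_dvd,
    ← Int.mem_zmultiples_iff]
  rfl

theorem index_eq_of_mem_iff (Q : Subgroup (Multiplicative ℤ)) (e : ℕ)
    (h : ∀ x, x ∈ Q ↔ (e : ℤ) ∣ x.toAdd) : Q.index = e := by
  have h' : ∀ x : ℤ, (Q.index : ℤ) ∣ x ↔ (e : ℤ) ∣ x := fun x => by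
    rw [← toAdd_ofAdd x, ← h, mem_iff_index_dvd]
  exact Nat.dvd_antisymm (Int.natCast_dvd_natCast.1 ((h' _).2 dvd_rfl))
    (Int.natCast_dvd_natCast.1 ((h' _).1 dvd_rfl))

section prod
variable {N : Type*} [CommGroup N]

/-- Tower `L ≤ L ⊔ N ≤ N × ℤ`, with `N` the kernel of the second projection: the lower index is that
of `L ∩ N` in `N`, the upper one that of the projection of `L`. -/
theorem index_eq_index_comap_mul (L : Subgroup (N × Multiplicative ℤ)) :
    L.index = (L.comap (MonoidHom.inl N (Multiplicative ℤ))).index *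
      (L.map (MonoidHom.snd N (Multiplicative ℤ))).index := by
  have hr : (MonoidHom.inl N (Multiplicative ℤ)).range = (MonoidHom.snd N (Multiplicative ℤ)).ker := by
    ext ⟨a, b⟩
    simp [Subgroup.mem_prod, eq_comm]
  rw [Subgroup.index_comap, Subgroup.index_map, hr, ← Subgroup.relIndex_sup_left,
    MonoidHom.range_eq_top.2 Prod.snd_surjective, Subgroup.index_top, mul_one,
    Subgroup.relIndex_mul_index le_sup_left]

/-- The subgroup of `N × ℤ` meeting `N` in `M`, projecting onto `e ℤ`, and containing `(w, e)` for
the elements `w` of the coset `v`. -/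
def twist (M : Subgroup N) (e : ℕ) (v : N ⧸ M) : Subgroup (N × Multiplicative ℤ) where
  carrier := {x | ∃ t : ℤ, x.2.toAdd = e * t ∧ (x.1 : N ⧸ M) = v ^ t}
  one_mem' := ⟨0, by simp⟩
  mul_mem' := by
    rintro x y ⟨s, hs, hs'⟩ ⟨t, ht, ht'⟩
    exact ⟨s + t, by simp [hs, ht, mul_add], by simp [hs', ht', zpow_add]⟩
  inv_mem' := by
    rintro x ⟨s, hs, hs'⟩
    exact ⟨-s, by simp [hs], by simp [hs']⟩

theorem mem_twist {M : Subgroup N} {e : ℕ} {v : N ⧸ M} {x : N × Multiplicative ℤ} :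
    x ∈ twist M e v ↔ ∃ t : ℤ, x.2.toAdd = e * t ∧ (x.1 : N ⧸ M) = v ^ t := Iff.rfl

theorem comap_twist (M : Subgroup N) {e : ℕ} (he : e ≠ 0) (v : N ⧸ M) :
    (twist M e v).comap (MonoidHom.inl N (Multiplicative ℤ)) = M := by
  ext w
  simp [mem_twist, he]

theorem index_map_twist (M : Subgroup N) (e : ℕ) (v : N ⧸ M) :
    ((twist M e v).map (MonoidHom.snd N (Multiplicative ℤ))).index = e := by
  refine index_eq_of_mem_iff _ _ fun x => ?_
  constructor
  · rintro ⟨y, ⟨t, ht, -⟩, rfl⟩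
    exact ⟨t, ht⟩
  · rintro ⟨t, ht⟩
    obtain ⟨w, hw⟩ := QuotientGroup.mk_surjective (v ^ t)
    exact ⟨(w, x), ⟨t, ht, hw⟩, rfl⟩

theorem index_twist (M : Subgroup N) {e : ℕ} (he : e ≠ 0) (v : N ⧸ M) :
    (twist M e v).index = M.index * e := by
  rw [index_eq_index_comap_mul, comap_twist M he, index_map_twist]

theorem twist_injective (M : Subgroup N) {e : ℕ} (he : e ≠ 0) :
    Function.Injective (twist M e) := by
  intro v v' h
  obtain ⟨w, rfl⟩ := QuotientGroup.mk_surjective v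
  have : (w, Multiplicative.ofAdd (e : ℤ)) ∈ twist M e (w : N ⧸ M) := ⟨1, by simp, by simp⟩
  rw [h] at this
  obtain ⟨t, ht, ht'⟩ := this
  have : t = 1 := by simpa [he] using ht.symm
  simpa [this] using ht'

/-- With `e` generating the projection of `L`, pick `(w, e) ∈ L`. Dividing by powers of `(w, e)`
reduces membership in `L` to membership in `L ∩ N`, so the class of `w` determines the rest. -/
theorem exists_twist_eq (L : Subgroup (N × Multiplicative ℤ)) :
    ∃ v, twist (L.comap (MonoidHom.inl N (Multiplicative ℤ)))
      (L.map (MonoidHom.snd N (Multiplicative ℤ))).index v = L := by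
  set e := (L.map (MonoidHom.snd N (Multiplicative ℤ))).index with he
  obtain ⟨⟨w, z⟩, hw, hz⟩ : Multiplicative.ofAdd (e : ℤ) ∈
      L.map (MonoidHom.snd N (Multiplicative ℤ)) := by
    rw [mem_iff_index_dvd]
    exact dvd_rfl
  obtain rfl : z = Multiplicative.ofAdd (e : ℤ) := hz
  refine ⟨(w : N ⧸ _), ?_⟩
  have key : ∀ (y : N) (t : ℤ), (y, Multiplicative.ofAdd ((e : ℤ) * t)) ∈ L ↔
      (y : N ⧸ L.comap (MonoidHom.inl N (Multiplicative ℤ))) = (w : N ⧸ _) ^ t := fun y t => by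
    rw [← QuotientGroup.mk_zpow, eq_comm, QuotientGroup.eq, Subgroup.mem_comap,
      ← Subgroup.mul_mem_cancel_left _ (zpow_mem hw (-t))]
    have : (w, Multiplicative.ofAdd (e : ℤ)) ^ (-t) * (y, Multiplicative.ofAdd ((e : ℤ) * t)) =
        (MonoidHom.inl N (Multiplicative ℤ)) ((w ^ t)⁻¹ * y) := by
      refine Prod.ext (by simp) ?_
      apply Multiplicative.toAdd.injective
      simp
    rw [this]
  ext ⟨y, z⟩
  rw [mem_twist]
  constructor
  · rintro ⟨t, ht, ht'⟩
    obtain rfl : z = Multiplicative.ofAdd ((e : ℤ) * t) := ht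
    exact (key y t).2 ht'
  · intro h
    obtain ⟨t, ht⟩ : (e : ℤ) ∣ z.toAdd := by
      rw [he, ← mem_iff_index_dvd]
      exact ⟨_, h, rfl⟩
    obtain rfl : z = Multiplicative.ofAdd ((e : ℤ) * t) := ht
    exact ⟨t, rfl, (key y t).1 h⟩

/-- Subgroups of index `n` correspond to triples `(M, e, v)` with `M.index * e = n` and `v ∈ N ⧸ M`;
the weight `d` is the number of cosets `v`. -/
theorem card_subgroup_prod {n : ℕ} (hn : n ≠ 0)
    (hfin : ∀ d, d ≠ 0 → Finite {M : Subgroup N // M.index = d}) :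
    Nat.card {L : Subgroup (N × Multiplicative ℤ) // L.index = n} =
      ∑ d ∈ n.divisors, d * Nat.card {M : Subgroup N // M.index = d} := by
  have hd0 : ∀ d : n.divisors, (d : ℕ) ≠ 0 := fun d => (Nat.pos_of_mem_divisors d.2).ne'
  have hdn : ∀ d : n.divisors, n / d ≠ 0 := fun d =>
    (Nat.div_pos (Nat.divisor_le d.2) (Nat.pos_of_ne_zero (hd0 d))).ne'
  have e : (Σ d : n.divisors, Σ M : {M : Subgroup N // M.index = d}, N ⧸ M.1) ≃
      {L : Subgroup (N × Multiplicative ℤ) // L.index = n} := by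
    refine Equiv.ofBijective (fun q => ⟨twist q.2.1.1 (n / q.1) q.2.2, ?_⟩) ⟨?_, ?_⟩
    · rw [index_twist _ (hdn _), q.2.1.2, Nat.mul_div_cancel' (Nat.dvd_of_mem_divisors q.1.2)]
    · rintro ⟨⟨d, hd⟩, ⟨M, hM⟩, v⟩ ⟨⟨d', hd'⟩, ⟨M', hM'⟩, v'⟩ h
      have h : twist M (n / d) v = twist M' (n / d') v' := Subtype.ext_iff.1 h
      have hMM : M = M' := by
        rw [← comap_twist M (hdn ⟨d, hd⟩) v, h, comap_twist M' (hdn ⟨d', hd'⟩) v']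
      subst hMM
      obtain rfl : d = d' := hM.symm.trans hM'
      rw [twist_injective M (hdn ⟨d, hd⟩) h]
    · rintro ⟨L, rfl⟩
      obtain ⟨v, hv⟩ := exists_twist_eq L
      have hi := index_eq_index_comap_mul L
      refine ⟨⟨⟨_, Nat.mem_divisors.2 ⟨Dvd.intro _ hi.symm, hn⟩⟩, ⟨_, rfl⟩, v⟩, Subtype.ext ?_⟩
      have : L.index / (L.comap (MonoidHom.inl N (Multiplicative ℤ))).index =
          (L.map (MonoidHom.snd N (Multiplicative ℤ))).index := by
        refine Nat.div_eq_of_eq_mul_right (Nat.pos_of_ne_zero fun h0 => hn ?_) hi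
        rw [hi, h0, zero_mul]
      simpa only [this] using hv
  rw [← Nat.card_congr e]
  have h1 : ∀ d : n.divisors, Finite {M : Subgroup N // M.index = d} := fun d => hfin d (hd0 d)
  have h2 : ∀ (d : n.divisors) (M : {M : Subgroup N // M.index = d}), Finite (N ⧸ M.1) :=
    fun d M => Subgroup.index_ne_zero_iff_finite.1 (by rw [M.2]; exact hd0 d)
  rw [Nat.card_sigma, 
    ← Finset.sum_coe_sort n.divisors fun d => d * Nat.card {M : Subgroup N // M.index = d}]
  refine Finset.sum_congr rfl fun d _ => ?_
  have := Fintype.ofFinite {M : Subgroup N // M.index = d}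
  rw [Nat.card_sigma]
  have : ∀ M : {M : Subgroup N // M.index = d}, Nat.card (N ⧸ M.1) = d := fun M => M.2
  simp only [this]
  rw [Finset.sum_const, smul_eq_mul, mul_comm, Finset.card_univ, Nat.card_eq_fintype_card]

end prod

theorem card_subgroup_congr {G G' : Type*} [Group G] [Group G'] (e : G ≃* G') (n : ℕ) :
    Nat.card {K : Subgroup G // K.index = n} = Nat.card {K : Subgroup G' // K.index = n} :=
  Nat.card_congr (e.mapSubgroup.toEquiv.subtypeEquiv fun K => by
    rw [← Subgroup.index_map_equiv K e]; rfl)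

/-- Splitting off the first coordinate of `FreeAb (p + 1)`. -/
def FreeAb.succEquiv (p : ℕ) : FreeAb p × Multiplicative ℤ ≃* FreeAb (p + 1) where
  toFun x := Fin.cons x.2 x.1
  invFun y := (Fin.tail y, y 0)
  left_inv x := by simp
  right_inv y := by simp
  map_mul' x y := by
    funext i
    refine Fin.cases ?_ (fun i => ?_) i <;> simp

theorem subgroupCount_succ (p : ℕ) {n : ℕ} (hn : n ≠ 0) :
    subgroupCount (p + 1) n = ∑ d ∈ n.divisors, d * subgroupCount p d := by
  rw [subgroupCount, ← card_subgroup_congr (FreeAb.succEquiv p),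
    card_subgroup_prod hn fun d hd => finite_subgroups p hd]
  rfl

theorem subgroupCount_one (p : ℕ) : subgroupCount p 1 = 1 := by
  rw [subgroupCount, Nat.card_eq_one_iff_unique]
  exact ⟨⟨fun K L => Subtype.ext ((Subgroup.index_eq_one.1 K.2).trans
    (Subgroup.index_eq_one.1 L.2).symm)⟩, ⟨⟨⊤, Subgroup.index_top⟩⟩⟩

theorem subgroupCount_zero {n : ℕ} (hn : n ≠ 1) : subgroupCount 0 n = 0 := by
  rw [subgroupCount, Nat.card_eq_zero]
  exact Or.inl ⟨fun K => hn (K.2.symm.trans (Subgroup.index_eq_one.2 (Subsingleton.elim _ _)))⟩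

open ArithmeticFunction

/-- `subgroupCount p` as an arithmetic function. -/
noncomputable def subgroupFun (p : ℕ) : ArithmeticFunction ℕ :=
  ⟨fun n => if n = 0 then 0 else subgroupCount p n, by simp⟩

theorem subgroupFun_apply (p : ℕ) {n : ℕ} (hn : n ≠ 0) : subgroupFun p n = subgroupCount p n :=
  if_neg hn

theorem subgroupFun_zero : subgroupFun 0 = 1 := by
  ext n
  rcases eq_or_ne n 0 with rfl | hn
  · simp
  rw [subgroupFun_apply _ hn, one_apply]
  split_ifs with h
  · rw [h, subgroupCount_one]
  · exact subgroupCount_zero h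

theorem subgroupFun_succ (p : ℕ) :
    subgroupFun (p + 1) = zeta * ArithmeticFunction.id.pmul (subgroupFun p) := by
  ext n
  rcases eq_or_ne n 0 with rfl | hn
  · simp
  rw [subgroupFun_apply _ hn, subgroupCount_succ p hn, zeta_mul_apply]
  refine Finset.sum_congr rfl fun d hd => ?_
  rw [pmul_apply, subgroupFun_apply _ (Nat.pos_of_mem_divisors hd).ne', id_apply]

theorem id_pmul_mul (f g : ArithmeticFunction ℕ) :
    ArithmeticFunction.id.pmul (f * g) =
      ArithmeticFunction.id.pmul f * ArithmeticFunction.id.pmul g := by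
  ext n
  simp only [pmul_apply, mul_apply, id_apply, Finset.mul_sum]
  refine Finset.sum_congr rfl fun x hx => ?_
  rw [← (Nat.mem_divisorsAntidiagonal.1 hx).1]
  ring

theorem id_pmul_pow (p : ℕ) : ArithmeticFunction.id.pmul (pow p) = pow (p + 1) := by
  ext n
  rcases eq_or_ne n 0 with rfl | hn
  · simp
  simp [pow_apply, hn, pow_succ']

/-- In terms of Dirichlet series, `subgroupFun p` is `ζ(s) ζ(s-1) ⋯ ζ(s-p+1)`. The first recursion
adds the factor `ζ(s)` after a shift; this one adds the last factor, and leaves coefficient `1` on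
the term `d = n`, which makes the normalised recursion contracting. -/
theorem subgroupFun_succ' (p : ℕ) : subgroupFun (p + 1) = pow p * subgroupFun p := by
  induction p with
  | zero =>
    rw [subgroupFun_succ, subgroupFun_zero, pow_zero_eq_zeta]
    congr 1
    ext n
    simp only [pmul_apply, id_apply, one_apply]
    split_ifs with h <;> simp [h]
  | succ p ih =>
    rw [subgroupFun_succ (p + 1), ih, id_pmul_mul, id_pmul_pow, mul_left_comm, ← subgroupFun_succ,
      ih]

theorem subgroupCount_succ' (p : ℕ) {n : ℕ} (hn : n ≠ 0) :
    subgroupCount (p + 1) n = ∑ d ∈ n.divisors, (n / d) ^ p * subgroupCount p d := by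
  rw [← subgroupFun_apply _ hn, subgroupFun_succ', mul_apply,
    Nat.sum_divisorsAntidiagonal' (f := fun a b => pow p a * subgroupFun p b)]
  refine Finset.sum_congr rfl fun d hd => ?_
  have hd0 := Nat.pos_of_mem_divisors hd
  rw [subgroupFun_apply _ hd0.ne', pow_apply, if_neg]
  exact fun h => (Nat.div_pos (Nat.divisor_le hd) hd0).ne' h.2

end CommutingPerms

/-! ### Asymptotics of the transitive counts -/

namespace CommutingPerms
open ArithmeticFunction Filter Topology

theorem H_one : H 1 = 1 := by simp [H]

theorem H_pos (n : ℕ) : 0 < H n := by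
  unfold H
  refine Finset.prod_pos fun q hq => ?_
  have hq : q.Prime := Nat.prime_of_mem_primeFactors hq
  have h1 : (1 : ℝ) < q := by exact_mod_cast hq.one_lt
  refine div_pos (zpow_pos (by linarith) _) (Finset.prod_pos fun j hj => ?_)
  exact sub_pos.2 (one_lt_pow₀ h1 (Nat.one_le_iff_ne_zero.1 (Finset.mem_Icc.1 hj).1))

theorem H_prime_pow {q : ℕ} (hq : q.Prime) (m : ℕ) :
    H (q ^ m) = (q : ℝ) ^ ((m.choose 2 : ℤ) - (m : ℤ)) / ∏ j ∈ Finset.Icc 1 m, ((q : ℝ) ^ j - 1) := by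
  unfold H
  rw [hq.factorization_pow, Finsupp.prod_single_index (by simp)]

/-- From `binom(m+1, 2) = binom(m, 2) + m`. It is the induction step for summing `mulH` over the
divisors of a prime power. -/
theorem H_prime_pow_succ {q : ℕ} (hq : q.Prime) (m : ℕ) :
    ((q : ℝ) ^ (m + 1) - 1) * ((q ^ (m + 1) : ℕ) * H (q ^ (m + 1))) =
      (q : ℝ) ^ m * ((q ^ m : ℕ) * H (q ^ m)) := by
  have h1 : (1 : ℝ) < q := by exact_mod_cast hq.one_lt
  have h0 : (q : ℝ) ≠ 0 := by linarith
  have h2 : ∀ j ∈ Finset.Icc 1 m, (q : ℝ) ^ j - 1 ≠ 0 := fun j hj =>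
    (sub_pos.2 (one_lt_pow₀ h1 (Nat.one_le_iff_ne_zero.1 (Finset.mem_Icc.1 hj).1))).ne'
  have h3 : (q : ℝ) ^ (m + 1) - 1 ≠ 0 := (sub_pos.2 (one_lt_pow₀ h1 m.succ_ne_zero)).ne'
  have h4 := Finset.prod_ne_zero_iff.2 h2
  rw [H_prime_pow hq, H_prime_pow hq, Finset.prod_Icc_succ_top (by omega)]
  have e : (q : ℝ) ^ (((m + 1).choose 2 : ℤ) - ((m + 1 : ℕ) : ℤ)) * (q : ℝ) ^ (m + 1) =
      (q : ℝ) ^ ((m.choose 2 : ℤ) - (m : ℤ)) * (q : ℝ) ^ m * (q : ℝ) ^ m := by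
    rw [← zpow_natCast, ← zpow_natCast, ← zpow_add₀ h0, ← zpow_add₀ h0, ← zpow_add₀ h0]
    congr 1
    rw [Nat.choose_succ_succ' m 1, Nat.choose_one_right]
    push_cast
    ring
  push_cast at e ⊢
  field_simp
  linear_combination e

/-- `n * H n` as an arithmetic function. -/
noncomputable def mulH : ArithmeticFunction ℝ := ⟨fun n => n * H n, by simp⟩

theorem mulH_apply (n : ℕ) : mulH n = n * H n := rfl

theorem isMultiplicative_mulH : mulH.IsMultiplicative :=
  ⟨by simp [mulH_apply, H_one], fun {m n} h => by
    rw [mulH_apply, mulH_apply, mulH_apply, H_mul h]; push_cast; ring⟩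

/-- The recursion characterising `H`. -/
theorem sum_divisors_mulH (n : ℕ) : ∑ d ∈ n.divisors, mulH d = n * mulH n := by
  have h : mulH * (zeta : ArithmeticFunction ℝ) =
      (ArithmeticFunction.id : ArithmeticFunction ℝ).pmul mulH := by
    rw [(isMultiplicative_mulH.mul isMultiplicative_zeta.natCast).eq_iff_eq_on_prime_powers _ _
      (isMultiplicative_id.natCast.pmul isMultiplicative_mulH)]
    intro q m hq
    rw [coe_mul_zeta_apply, Nat.sum_divisors_prime_pow hq, pmul_apply, natCoe_apply, id_apply]
    induction m with
    | zero => simp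
    | succ m ih =>
      have := H_prime_pow_succ hq m
      rw [Finset.sum_range_succ, ih]
      simp only [mulH_apply] at this ⊢
      push_cast at this ⊢
      linarith
  rw [← coe_mul_zeta_apply, h, pmul_apply, natCoe_apply, id_apply]

theorem tendsto_zero_of_affine_recursion {a b : ℕ → ℝ} {r : ℝ} (hr0 : 0 ≤ r) (hr1 : r < 1)
    (hab : ∀ p, a (p + 1) = r * a p + b p) (hb : Tendsto b atTop (𝓝 0)) :
    Tendsto a atTop (𝓝 0) := by
  rw [Metric.tendsto_atTop]
  intro ε hε
  have hs : 0 < 1 - r := sub_pos.2 hr1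
  -- With this tolerance `ε / 2` is the fixed point of `x ↦ r x + ε / 2 * (1 - r)`, so the bound
  -- below propagates.
  obtain ⟨P, hP⟩ := Metric.tendsto_atTop.1 hb (ε / 2 * (1 - r)) (by positivity)
  have hbound : ∀ m, |a (P + m)| ≤ r ^ m * |a P| + ε / 2 := by
    intro m
    induction m with
    | zero => simp; positivity
    | succ m ih =>
      have h1 := hP (P + m) (by omega)
      rw [Real.dist_eq, sub_zero] at h1
      rw [← add_assoc, hab]
      calc |r * a (P + m) + b (P + m)| ≤ r * |a (P + m)| + |b (P + m)| := by
            refine (abs_add_le _ _).trans ?_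
            rw [abs_mul, abs_of_nonneg hr0]
        _ ≤ r * (r ^ m * |a P| + ε / 2) + ε / 2 * (1 - r) := by gcongr
        _ = r ^ (m + 1) * |a P| + ε / 2 := by ring
  have ht : Tendsto (fun m => r ^ m * |a P|) atTop (𝓝 0) := by
    simpa using (tendsto_pow_atTop_nhds_zero_of_lt_one hr0 hr1).mul_const |a P|
  obtain ⟨M, hM⟩ := (ht.eventually (gt_mem_nhds (half_pos hε))).exists_forall_of_atTop
  refine ⟨P + M, fun p hp => ?_⟩
  obtain ⟨m, rfl⟩ := Nat.exists_eq_add_of_le (show P ≤ p by omega)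
  have h1 := hbound m
  have h2 := hM m (by omega)
  rw [Real.dist_eq, sub_zero]
  linarith

theorem tendsto_of_affine_recursion {a b : ℕ → ℝ} {r l : ℝ} (hr0 : 0 ≤ r) (hr1 : r < 1)
    (hab : ∀ p, a (p + 1) = r * a p + b p) (hb : Tendsto b atTop (𝓝 ((1 - r) * l))) :
    Tendsto a atTop (𝓝 l) := by
  rw [← tendsto_sub_nhds_zero_iff] at hb ⊢
  refine tendsto_zero_of_affine_recursion hr0 hr1 (fun p => ?_) hb
  rw [hab]
  ring

theorem subgroupCount_div_pow_succ (p : ℕ) {n : ℕ} (hn : n ≠ 0) :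
    (subgroupCount (p + 1) n : ℝ) / (n : ℝ) ^ (p + 1) =
      (n : ℝ)⁻¹ * ∑ d ∈ n.divisors, (subgroupCount p d : ℝ) / (d : ℝ) ^ p := by
  have hn' : (n : ℝ) ≠ 0 := by exact_mod_cast hn
  rw [subgroupCount_succ' p hn, Nat.cast_sum, Finset.sum_div, Finset.mul_sum]
  refine Finset.sum_congr rfl fun d hd => ?_
  have hd' : (d : ℝ) ≠ 0 := by exact_mod_cast (Nat.pos_of_mem_divisors hd).ne'
  rw [Nat.cast_mul, Nat.cast_pow, Nat.cast_div (Nat.dvd_of_mem_divisors hd) hd', pow_succ,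
    div_pow]
  field_simp

/-- Strong induction on `n`: the term `d = n` gives the contraction factor `1 / n`, and the proper
divisors give a convergent forcing term. The factor is not below `1` for `n = 1`, where the sequence
is constant. -/
theorem tendsto_subgroupCount {n : ℕ} (hn : n ≠ 0) :
    Tendsto (fun p => (subgroupCount p n : ℝ) / (n : ℝ) ^ p) atTop (𝓝 (mulH n)) := by
  induction n using Nat.strong_induction_on with
  | _ n ih =>
    rcases eq_or_ne n 1 with rfl | h1
    · simp [subgroupCount_one, mulH_apply, H_one]
    have hn2 : (1 : ℝ) < n := by exact_mod_cast (show 1 < n by omega)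
    have hn' : (n : ℝ) ≠ 0 := by linarith
    refine tendsto_of_affine_recursion (r := (n : ℝ)⁻¹) (by positivity)
      (inv_lt_one_of_one_lt₀ hn2) (fun p => ?_)
      (b := fun p => (n : ℝ)⁻¹ * ∑ d ∈ n.properDivisors, (subgroupCount p d : ℝ) / (d : ℝ) ^ p) ?_
    · rw [subgroupCount_div_pow_succ p hn, ← Nat.cons_self_properDivisors hn, Finset.sum_cons]
      ring
    · have hs := sum_divisors_mulH n
      rw [← Nat.cons_self_properDivisors hn, Finset.sum_cons] at hs
      have : (1 - (n : ℝ)⁻¹) * mulH n = (n : ℝ)⁻¹ * ∑ d ∈ n.properDivisors, mulH d := by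
        field_simp
        linarith
      rw [this]
      refine Tendsto.const_mul _ (tendsto_finsetSum _ fun d hd => ?_)
      exact ih d (Nat.mem_properDivisors.1 hd).2 (Nat.pos_of_mem_properDivisors hd).ne'

/-- The number of commuting transitive tuples is asymptotic to `n! * H n * n ^ p`. -/
theorem tendsto_transCount {n : ℕ} (hn : n ≠ 0) :
    Tendsto (fun p => (transCount p n : ℝ) / (n : ℝ) ^ p) atTop (𝓝 (n.factorial * H n)) := by
  have hn' : (n : ℝ) ≠ 0 := by exact_mod_cast hn
  have h := (tendsto_subgroupCount hn).const_mul ((n.factorial : ℝ) / n)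
  rw [mulH_apply] at h
  have e : (n.factorial : ℝ) / n * (n * H n) = n.factorial * H n := by field_simp
  rw [e] at h
  refine h.congr fun p => ?_
  have := transCount_mul p hn
  have : (transCount p n : ℝ) * n = n.factorial * subgroupCount p n := by exact_mod_cast this
  field_simp
  linarith

end CommutingPerms

/-! ### Fibre sizes, maximal products and the final limit -/

namespace CommutingPerms
open Filter Topology

section fibersizes
variable {X : Type*} {k : ℕ}

/-- The number of maps with prescribed fibre sizes is a multinomial coefficient. -/
theorem card_maps_with_fibers [Finite X] (a : Fin k → ℕ) (ha : ∑ j, a j = Nat.card X) :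
    Nat.card {f : X → Fin k // ∀ j, Nat.card {x // f x = j} = a j} * ∏ j, (a j).factorial =
      (Nat.card X).factorial := by
  let S := {f : X → Fin k // ∀ j, Nat.card {x // f x = j} = a j}
  -- A bijection onto `Σ j, Fin (a j)` is a map with the prescribed fibre sizes together with a
  -- numbering of each fibre.
  let glue : (Σ f : S, ∀ j, {x // f.1 x = j} ≃ Fin (a j)) → (X ≃ Σ j, Fin (a j)) := fun q =>
    (Equiv.sigmaFiberEquiv q.1.1).symm.trans (Equiv.sigmaCongrRight q.2)
  have hglue : ∀ q x, glue q x = ⟨q.1.1 x, q.2 (q.1.1 x) ⟨x, rfl⟩⟩ := fun q x => rfl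
  have hbij : Function.Bijective glue := by
    constructor
    · rintro ⟨⟨f, hf⟩, e⟩ ⟨⟨f', hf'⟩, e'⟩ h
      have hx : ∀ x, (⟨f x, e (f x) ⟨x, rfl⟩⟩ : Σ j, Fin (a j)) = ⟨f' x, e' (f' x) ⟨x, rfl⟩⟩ :=
        fun x => by simpa only [hglue] using DFunLike.congr_fun h x
      obtain rfl : f = f' := funext fun x => (Sigma.mk.inj_iff.1 (hx x)).1
      congr 1
      funext j
      ext ⟨x, rfl⟩
      exact congrArg Fin.val (eq_of_heq (Sigma.mk.inj_iff.1 (hx x)).2)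
    · intro E
      let e : ∀ j, {x // (E x).1 = j} ≃ Fin (a j) := fun j =>
        (E.subtypeEquiv fun _ => Iff.rfl).trans (Equiv.sigmaSubtype j)
      refine ⟨⟨⟨fun x => (E x).1, fun j => ?_⟩, e⟩, ?_⟩
      · rw [Nat.card_congr (e j), Nat.card_fin]
      · ext x : 1
        rfl
  have hcard : Nat.card (Σ j, Fin (a j)) = Nat.card X := by
    rw [Nat.card_sigma, ← ha]; simp
  have : Fintype S := Fintype.ofFinite S
  have h1 : ∀ f : S, Nat.card (∀ j, {x // f.1 x = j} ≃ Fin (a j)) = ∏ j, (a j).factorial := by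
    intro f
    rw [Nat.card_pi]
    refine Finset.prod_congr rfl fun j _ => ?_
    have e := Finite.equivFinOfCardEq (f.2 j)
    rw [Nat.card_congr (Equiv.equivCongr e (Equiv.refl _)), Nat.card_eq_fintype_card,
      Fintype.card_perm, Fintype.card_fin]
  have h2 : Nat.card (X ≃ Σ j, Fin (a j)) = (Nat.card X).factorial := by
    have e := Finite.equivFin X
    have e' := Finite.equivFinOfCardEq hcard
    rw [Nat.card_congr (Equiv.equivCongr e e'), Nat.card_eq_fintype_card,
      Fintype.card_perm, Fintype.card_fin]
  rw [← h2, ← Nat.card_congr (Equiv.ofBijective glue hbij), Nat.card_sigma]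
  simp only [h1]
  rw [Finset.sum_const, smul_eq_mul, Finset.card_univ, Nat.card_eq_fintype_card]

theorem sum_card_fibers [Finite X] (f : X → Fin k) :
    ∑ j, Nat.card {x // f x = j} = Nat.card X := by
  rw [← Nat.card_sigma, Nat.card_congr (Equiv.sigmaFiberEquiv f)]

theorem surjective_iff_card_fibers_pos [Finite X] (f : X → Fin k) :
    f.Surjective ↔ ∀ j, 1 ≤ Nat.card {x // f x = j} := by
  refine forall_congr' fun j => ?_
  rw [Nat.one_le_iff_ne_zero, ← Nat.pos_iff_ne_zero, Finite.card_pos_iff, nonempty_subtype]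

end fibersizes

section balanced
variable {n k : ℕ}

/-- All the entries are `n / k` or `n / k + 1`. -/
def Balanced (n : ℕ) {k : ℕ} (a : Fin k → ℕ) : Prop := ∀ j, a j = n / k ∨ a j = n / k + 1

theorem sum_eq_of_two_values {m : ℕ} {a : Fin k → ℕ} (h : ∀ j, a j = m ∨ a j = m + 1) :
    ∑ j, a j = k * m + (Finset.univ.filter fun j => a j = m + 1).card := by
  have : ∀ j, a j = m + if a j = m + 1 then 1 else 0 := fun j => by
    rcases h j with h | h <;> simp [h]
  rw [Finset.sum_congr rfl fun j _ => this j, Finset.sum_add_distrib, Finset.card_filter]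
  simp

theorem Balanced.card_filter {a : Fin k → ℕ} (h : Balanced n a)
    (hn : ∑ j, a j = n) : (Finset.univ.filter fun j => a j = n / k + 1).card = n % k := by
  have h1 := sum_eq_of_two_values h
  have h2 := Nat.div_add_mod n k
  omega

theorem Balanced.prod_eq {R : Type*} [CommMonoid R] {a : Fin k → ℕ}
    (h : Balanced n a) (hn : ∑ j, a j = n) (g : ℕ → R) :
    ∏ j, g (a j) = g (n / k) ^ (k - n % k) * g (n / k + 1) ^ (n % k) := by
  have h1 : ∀ j, g (a j) = if a j = n / k + 1 then g (n / k + 1) else g (n / k) := fun j => by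
    rcases h j with h | h <;> simp [h]
  have h2 := h.card_filter hn
  have h3 : (Finset.univ.filter fun j => ¬ a j = n / k + 1).card = k - n % k := by
    have := Finset.card_filter_add_card_filter_not (s := (Finset.univ : Finset (Fin k)))
      (fun j => a j = n / k + 1)
    rw [Finset.card_univ, Fintype.card_fin] at this
    omega
  rw [Finset.prod_congr rfl fun j _ => h1 j, Finset.prod_ite, Finset.prod_const,
    Finset.prod_const, h2, h3, mul_comm]

/-- If `a j ≥ a i + 2`, moving one unit from `j` to `i` keeps the sum and strictly increases the
product. -/
theorem le_add_one_of_prod_eq_E (hk : 1 ≤ k) (hkn : k ≤ n) {a : Fin k → ℕ}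
    (h1 : ∀ j, 1 ≤ a j) (hn : ∑ j, a j = n) (hE : ∏ j, a j = E n k) (i j : Fin k) :
    a j ≤ a i + 1 := by
  by_contra! hij
  have hne : j ≠ i := by rintro rfl; omega
  have hj : j ∈ Finset.univ.erase i := Finset.mem_erase.2 ⟨hne, Finset.mem_univ _⟩
  let a' : Fin k → ℕ := Function.update (Function.update a i (a i + 1)) j (a j - 1)
  have hi' : a' i = a i + 1 := by simp [a', hne.symm]
  have hj' : a' j = a j - 1 := by simp [a']
  have hr : ∀ l ∈ (Finset.univ.erase i).erase j, a' l = a l := fun l hl => by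
    simp only [Finset.mem_erase] at hl
    simp [a', hl.1, hl.2.1]
  have hsr : ∑ l ∈ (Finset.univ.erase i).erase j, a' l =
      ∑ l ∈ (Finset.univ.erase i).erase j, a l :=
    Finset.sum_congr rfl hr
  have hs : ∑ l, a' l = n := by
    have e1 := Finset.add_sum_erase _ a (Finset.mem_univ i)
    have e2 := Finset.add_sum_erase _ a hj
    have e3 := Finset.add_sum_erase _ a' (Finset.mem_univ i)
    have e4 := Finset.add_sum_erase _ a' hj
    omega
  have h1' : ∀ l, 1 ≤ a' l := fun l => by
    by_cases hl : l = j
    · rw [hl, hj']; omega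
    by_cases hl' : l = i
    · rw [hl', hi']; omega
    rw [hr l (by simp [hl, hl'])]
    exact h1 l
  have hle := (isGreatest_E hk hkn).2 ⟨a', h1', hs, rfl⟩
  rw [← hE, ← Finset.mul_prod_erase _ a (Finset.mem_univ i), ← Finset.mul_prod_erase _ a hj,
      ← Finset.mul_prod_erase _ a' (Finset.mem_univ i), ← Finset.mul_prod_erase _ a' hj,
      Finset.prod_congr rfl hr, hi', hj', ← mul_assoc, ← mul_assoc] at hle
  have hpos : 0 < ∏ l ∈ (Finset.univ.erase i).erase j, a l := Finset.prod_pos fun l _ => h1 l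
  have := Nat.le_of_mul_le_mul_right hle hpos
  -- Writing `a j = a i + 1 + c + 1`, the move changes `a i * a j` by `c + 1 > 0`.
  obtain ⟨c, hc⟩ := Nat.exists_eq_add_of_lt hij
  rw [hc] at this
  simp only [Nat.add_sub_cancel] at this
  nlinarith

/-- The maximisers of the product are balanced. -/
theorem balanced_of_prod_eq_E (hk : 1 ≤ k) (hkn : k ≤ n) {a : Fin k → ℕ}
    (h1 : ∀ j, 1 ≤ a j) (hn : ∑ j, a j = n) (hE : ∏ j, a j = E n k) : Balanced n a := by
  have : Nonempty (Fin k) := ⟨⟨0, hk⟩⟩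
  obtain ⟨i, hi⟩ := Finite.exists_min a
  have h : ∀ j, a j = a i ∨ a j = a i + 1 := fun j => by
    have := hi j
    have := le_add_one_of_prod_eq_E hk hkn h1 hn hE i j
    omega
  have hs := sum_eq_of_two_values h
  -- The minimising index `i` is not counted, so this number is a genuine remainder and `a i` is the
  -- quotient.
  have hlt : (Finset.univ.filter fun j => a j = a i + 1).card < k := by
    have := Finset.card_lt_univ_of_notMem (s := Finset.univ.filter fun j => a j = a i + 1)
      (x := i) (by simp)
    simpa using this
  have hd : n / k = a i := by
    rw [← hn, hs, Nat.mul_add_div (by omega), Nat.div_eq_of_lt hlt, add_zero]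
  intro j
  rw [hd]
  exact h j

/-- For the converse, all balanced vectors of sum `n` have the same product, and some maximiser is
balanced. -/
theorem prod_eq_E_iff_balanced (hk : 1 ≤ k) (hkn : k ≤ n) {a : Fin k → ℕ}
    (h1 : ∀ j, 1 ≤ a j) (hn : ∑ j, a j = n) : ∏ j, a j = E n k ↔ Balanced n a := by
  refine ⟨balanced_of_prod_eq_E hk hkn h1 hn, fun h => ?_⟩
  obtain ⟨a', h1', hn', hE'⟩ := (isGreatest_E hk hkn).1
  have := (balanced_of_prod_eq_E hk hkn h1' hn' hE').prod_eq hn' fun m => m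
  rw [← hE', this]
  exact h.prod_eq hn fun m => m

-- Choose the `n % k` labels with the larger fibres; each choice leaves a multinomial number of
-- maps.
open Classical in
theorem card_balanced_maps :
    (Finset.univ.filter fun f : Fin n → Fin k =>
      Balanced n fun j => Nat.card {x // f x = j}).card *
      ((n / k).factorial ^ (k - n % k) * (n / k + 1).factorial ^ (n % k)) =
      k.choose (n % k) * n.factorial := by
  let T : (Fin n → Fin k) → Finset (Fin k) := fun f =>
    Finset.univ.filter fun j => Nat.card {x // f x = j} = n / k + 1
  have hT : ∀ f ∈ Finset.univ.filter (fun f : Fin n → Fin k =>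
      Balanced n fun j => Nat.card {x // f x = j}),
      T f ∈ Finset.powersetCard (n % k) Finset.univ := fun f hf => by
    rw [Finset.mem_powersetCard]
    exact ⟨Finset.subset_univ _, (Finset.mem_filter.1 hf).2.card_filter
      ((sum_card_fibers f).trans (Nat.card_fin n))⟩
  rw [Finset.card_eq_sum_card_fiberwise hT, Finset.sum_mul]
  have key : ∀ s ∈ Finset.powersetCard (n % k) (Finset.univ : Finset (Fin k)),
      ((Finset.univ.filter fun f : Fin n → Fin k =>
        Balanced n fun j => Nat.card {x // f x = j}).filter fun f => T f = s).card *
      ((n / k).factorial ^ (k - n % k) * (n / k + 1).factorial ^ (n % k)) = n.factorial := by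
    intro s hs
    let a : Fin k → ℕ := fun j => if j ∈ s then n / k + 1 else n / k
    have hab : ∀ j, a j = n / k ∨ a j = n / k + 1 := fun j => by
      by_cases hj : j ∈ s <;> simp [a, hj]
    have has : Finset.univ.filter (fun j => a j = n / k + 1) = s := by
      ext j
      by_cases hj : j ∈ s <;> simp [a, hj]
    have han : ∑ j, a j = n := by
      rw [sum_eq_of_two_values hab, has, (Finset.mem_powersetCard.1 hs).2, Nat.div_add_mod]
    have hcount := card_maps_with_fibers (X := Fin n) a (by rw [han, Nat.card_fin])
    rw [Balanced.prod_eq (n := n) hab han Nat.factorial, Nat.card_fin] at hcount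
    rw [← hcount]
    congr 1
    rw [Nat.card_eq_fintype_card, Fintype.card_subtype, Finset.filter_filter]
    congr 1
    ext f
    simp only [Finset.mem_filter, Finset.mem_univ, true_and]
    constructor
    · rintro ⟨hb, rfl⟩ j
      have hb' : Nat.card {x // f x = j} = n / k ∨ Nat.card {x // f x = j} = n / k + 1 := hb j
      simp only [a, T, Finset.mem_filter, Finset.mem_univ, true_and]
      split_ifs with h
      · exact h
      · exact hb'.resolve_right h
    · intro h
      refine ⟨fun j => by simpa only [h] using hab j, ?_⟩
      simp only [T, h]
      exact has
  rw [Finset.sum_congr rfl key, Finset.sum_const, Finset.card_powersetCard, smul_eq_mul,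
    Finset.card_univ, Fintype.card_fin]

end balanced

theorem E_pos {n k : ℕ} (hk : 1 ≤ k) (hkn : k ≤ n) : 0 < E n k := by
  obtain ⟨a, h1, -, hE⟩ := (isGreatest_E hk hkn).1
  rw [← hE]
  exact Finset.prod_pos fun j _ => h1 j

theorem F_pos (n k : ℕ) : 0 < F n k := by
  unfold F
  have := H_pos (n / k)
  have := H_pos (n / k + 1)
  positivity

-- Normalising each factor by `(a j)^p` leaves `(∏ a j / E n k)^p`, which is constantly `1` for
-- balanced `a` and decays geometrically otherwise.
open Classical in
theorem tendsto_prod_transCount {n k : ℕ} (hk : 1 ≤ k) (hkn : k ≤ n) {a : Fin k → ℕ}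
    (h1 : ∀ j, 1 ≤ a j) (hn : ∑ j, a j = n) :
    Tendsto (fun p => (∏ j, (transCount p (a j) : ℝ)) / (E n k : ℝ) ^ p) atTop
      (𝓝 (if Balanced n a then ∏ j, ((a j).factorial * H (a j)) else 0)) := by
  have hE : (0 : ℝ) < E n k := by exact_mod_cast E_pos hk hkn
  have hlim : Tendsto (fun p => ∏ j, ((transCount p (a j) : ℝ) / (a j : ℝ) ^ p)) atTop
      (𝓝 (∏ j, ((a j).factorial * H (a j)))) :=
    tendsto_finsetProd _ fun j _ => tendsto_transCount (Nat.one_le_iff_ne_zero.1 (h1 j))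
  have hprod : ∀ p, (∏ j, (transCount p (a j) : ℝ)) / (E n k : ℝ) ^ p =
      (∏ j, ((transCount p (a j) : ℝ) / (a j : ℝ) ^ p)) * (((∏ j, a j : ℕ) : ℝ) / E n k) ^ p := by
    intro p
    have h0 : (∏ j, (a j : ℝ)) ≠ 0 := Finset.prod_ne_zero_iff.2 fun j _ => by
      exact_mod_cast Nat.one_le_iff_ne_zero.1 (h1 j)
    rw [Finset.prod_div_distrib, Finset.prod_pow, div_pow, Nat.cast_prod]
    field_simp
  simp only [hprod]
  split_ifs with hb
  · rw [(prod_eq_E_iff_balanced hk hkn h1 hn).2 hb, div_self hE.ne']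
    simpa using hlim
  · have hlt : ∏ j, a j < E n k := lt_of_le_of_ne ((isGreatest_E hk hkn).2 ⟨a, h1, hn, rfl⟩)
      fun h => hb ((prod_eq_E_iff_balanced hk hkn h1 hn).1 h)
    have := hlim.mul (tendsto_pow_atTop_nhds_zero_of_lt_one (r := ((∏ j, a j : ℕ) : ℝ) / E n k)
      (by positivity) ((div_lt_one hE).2 (by exact_mod_cast hlt)))
    simpa using this

open Classical in
theorem sum_balanced_eq {n k : ℕ} (hk : 1 ≤ k) (hkn : k ≤ n) :
    (∑ f : Fin n → Fin k with f.Surjective, if Balanced n fun j => Nat.card {x // f x = j} then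
      ∏ j, ((Nat.card {x // f x = j}).factorial * H (Nat.card {x // f x = j})) else 0) =
      F n k * k.factorial := by
  have hb : 1 ≤ n / k := (Nat.one_le_div_iff (by omega)).2 hkn
  have hr : n % k ≤ k := (Nat.mod_lt n (by omega)).le
  rw [← Finset.sum_filter, Finset.filter_filter]
  -- Since `k ≤ n` gives `n / k ≥ 1`, balanced maps are automatically surjective.
  have hset : Finset.univ.filter (fun f : Fin n → Fin k =>
      f.Surjective ∧ Balanced n fun j => Nat.card {x // f x = j}) =
      Finset.univ.filter fun f => Balanced n fun j => Nat.card {x // f x = j} := by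
    refine Finset.filter_congr fun f _ => and_iff_right_of_imp fun h => ?_
    rw [surjective_iff_card_fibers_pos]
    intro j
    have := h j
    simp only at this
    omega
  rw [hset, Finset.sum_congr rfl fun f hf => (Finset.mem_filter.1 hf).2.prod_eq
    ((sum_card_fibers f).trans (Nat.card_fin n)) fun m => (m.factorial : ℝ) * H m,
    Finset.sum_const, nsmul_eq_mul]
  have hc : ((Finset.univ.filter fun f : Fin n → Fin k =>
      Balanced n fun j => Nat.card {x // f x = j}).card : ℝ) *
      (((n / k).factorial : ℝ) ^ (k - n % k) * ((n / k + 1).factorial : ℝ) ^ (n % k)) =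
      k.choose (n % k) * n.factorial := by
    exact_mod_cast card_balanced_maps (n := n) (k := k)
  rw [Nat.cast_choose ℝ hr] at hc
  rw [mul_pow, mul_pow, F]
  linear_combination (H (n / k) ^ (k - n % k) * H (n / k + 1) ^ (n % k)) * hc

theorem tendsto_A_div {n k : ℕ} (hk : 1 ≤ k) (hkn : k ≤ n) :
    Tendsto (fun p => (A p n k : ℝ) / (E n k : ℝ) ^ p) atTop (𝓝 (F n k)) := by
  classical
  have hk0 : (k.factorial : ℝ) ≠ 0 := by exact_mod_cast k.factorial_ne_zero
  have hsum := tendsto_finsetSum (Finset.univ.filter fun f : Fin n → Fin k => f.Surjective)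
    fun f hf => tendsto_prod_transCount hk hkn
      ((surjective_iff_card_fibers_pos f).1 (Finset.mem_filter.1 hf).2)
      ((sum_card_fibers f).trans (Nat.card_fin n))
  rw [sum_balanced_eq hk hkn] at hsum
  have := hsum.div_const (k.factorial : ℝ)
  rw [mul_div_cancel_right₀ _ hk0] at this
  refine this.congr fun p => ?_
  have hA : (A p n k : ℝ) * k.factorial = ∑ f : Fin n → Fin k with f.Surjective,
      ∏ j, (transCount p (Nat.card {x // f x = j}) : ℝ) := by
    exact_mod_cast A_mul_factorial p n k
  rw [← Finset.sum_div, ← hA]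
  field_simp

end CommutingPerms

theorem theorem2 (n k : ℕ) (hk : 1 ≤ k) (hkn : k ≤ n) :
    Filter.Tendsto
      (fun p : ℕ => (CommutingPerms.A p n k : ℝ) /
        (CommutingPerms.F n k * (CommutingPerms.E n k : ℝ) ^ p))
      Filter.atTop (nhds 1) := by
  have hF := (CommutingPerms.F_pos n k).ne'
  have h := (CommutingPerms.tendsto_A_div hk hkn).div_const (CommutingPerms.F n k)
  rw [div_self hF] at h
  refine h.congr fun p => ?_
  rw [div_div, mul_comm]
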